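/- Let $(X,\mathcal B,\mu)$ be a probability space and let $\tau:X\to X$ be an invertible bimeasurable measure-preserving transformation that is ergodic. For measurable scalar-valued functions $f,h$ on $X$ define the bilinear tail maximal operator $$\mathscr B^*(f,h)(x)=\sup_{m\in\mathbb Z}\left|\frac{f(\tau^m x)\,h(\tau^{2m}x)}{|m|+1}\right|\in[0,\infty],\qquad x\in X .$$ Let $1<p,q\le\infty$ and let $r_1,r_2$ be given by $\frac1{r_1}=1+\frac1q$ and $\frac1{r_2}=\frac1p+1$. Then there exists a constant $C>0$ such that for all $\alpha>0$ $$\mu\bigl(\{x\in X:\mathscr B^*(f,h)(x)>\alpha\}\bigr)\le\frac{C}{\alpha^{r_1}}\,\|f\|_{L^1(X)}^{r_1}\,\|h\|_{L^q(X)}^{r_1}\qquad\text{for all } f\in L^1(X),\ h\in L^q(X),$$ and $$\mu\bigl(\{x\in X:\mathscr B^*(f,h)(x)>\alpha\}\bigr)\le\frac{C}{\alpha^{r_2}}\,\|f\|_{L^p(X)}^{r_2}\,\|h\|_{L^1(X)}^{r_2}\qquad\text{for all } f\in L^p(X),\ h\in L^1(X).$$ In other words, $\mathscr B^*$ is of weak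 type $L^1\times L^q\to L^{r_1,\infty}$ and $L^p\times L^1\to L^{r_2,\infty}$, where in each case $r_i$ is the Hölder exponent of the two spaces on the left. -/

import Mathlib

open MeasureTheory
open scoped ENNReal

/-- The bilinear average `B_m(f, h)(x) = f (τ^m x) * h (τ^(2m) x) / (|m| + 1)`, `m : ℤ`, attached to
an invertible bimeasurable transformation `τ` of `X`. -/
noncomputable def bilinearTail {X 𝕜 : Type*} [MeasurableSpace X] [RCLike 𝕜]
    (τ : X ≃ᵐ X) (m : ℤ) (f h : X → 𝕜) (x : X) : 𝕜 :=
  f ((τ.toEquiv ^ m : Equiv.Perm X) x) * h ((τ.toEquiv ^ (2 * m) : Equiv.Perm X) x) /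
    (((|m| + 1 : ℤ)) : 𝕜)

/-- The bilinear tail maximal operator `B^*(f, h)(x) = sup_{m ∈ ℤ} |B_m(f, h)(x)|`, with values
in `[0, ∞]`. -/
noncomputable def bilinearTailMaximal {X 𝕜 : Type*} [MeasurableSpace X] [RCLike 𝕜]
    (τ : X ≃ᵐ X) (f h : X → 𝕜) (x : X) : ℝ≥0∞ :=
  ⨆ m : ℤ, ‖bilinearTail τ m f h x‖ₑ

/-! Normalise so that `∫ F ≤ V` and `∫ H ^ q ≤ V`, where `F` and `H` are rescaled moduli of the
integrable factor and the other one. By the maximal ergodic theorem, outside a set `D` of measure at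
most `2 * V` the two-sided averages of `H ^ q` along the orbit are bounded
(`exists_measurableSet_sum_zpow_le`). A point `x ∉ D` where the operator exceeds one at time `m` is
charged to `y = τ^(i m) x`, the argument of `F`. By invariance the measure of all such `x` is at
most the integral over `y` of the number of charging times `m`. That number is `O(F y)`
(`tsum_exceedance_le`): in a dyadic block `|m| ∼ 2^k`, a single good base point controls the sum of
`H ^ q` over the whole block, so Chebyshev gives `O(2^k * min 1 ((F y / 2^k) ^ q))` times, and this
sums to `O(F y)` because `q > 1`. Hence the exceedance set has measure `O(V)`. Only the product of
the two factors matters, so choosing `V` by homogeneity gives the exponent `1 / (1 + 1 / q)`. The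
two estimates are the cases `(i, j) = (1, 2)` and `(2, 1)`. -/

/-! ### The one-sided maximal ergodic theorem. -/

/-- The running maximum of `0` and the Birkhoff sums of `g - 1` of length at most `n`. -/
noncomputable def birkhoffExcess {X : Type*} (T : X → X) (g : X → ℝ≥0∞) : ℕ → X → ℝ≥0∞
  | 0 => 0
  | n + 1 => fun x => g x + birkhoffExcess T g n (T x) - 1

lemma birkhoffExcess_le_succ {X : Type*} (T : X → X) (g : X → ℝ≥0∞) (n : ℕ) (x : X) :
    birkhoffExcess T g n x ≤ birkhoffExcess T g (n + 1) x := by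
  induction n generalizing x with
  | zero => simp [birkhoffExcess]
  | succ n ih =>
    rw [birkhoffExcess, birkhoffExcess]
    exact tsub_le_tsub_right (add_le_add_right (ih _) _) 1

lemma birkhoffSum_le_birkhoffExcess_add {X : Type*} (T : X → X) (g : X → ℝ≥0∞) (n : ℕ) (x : X) :
    birkhoffSum T g n x ≤ birkhoffExcess T g n x + n := by
  induction n generalizing x with
  | zero => simp [birkhoffExcess]
  | succ n ih =>
    rw [birkhoffSum_succ', birkhoffExcess]
    calc g x + birkhoffSum T g n (T x) ≤ g x + (birkhoffExcess T g n (T x) + n) := by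
          gcongr; exact ih _
      _ = (g x + birkhoffExcess T g n (T x)) + n := by ring
      _ ≤ (g x + birkhoffExcess T g n (T x) - 1 + 1) + n := by
          exact add_le_add_left le_tsub_add _
      _ = _ := by push_cast; ring

lemma measurable_birkhoffExcess {X : Type*} [MeasurableSpace X] {T : X → X} {g : X → ℝ≥0∞}
    (hT : Measurable T) (hg : Measurable g) (n : ℕ) : Measurable (birkhoffExcess T g n) := by
  induction n with
  | zero => exact measurable_const
  | succ n ih => exact (hg.add (ih.comp hT)).sub_const 1

lemma lintegral_birkhoffExcess_le {X : Type*} [MeasurableSpace X] {μ : Measure X} {T : X → X}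
    {g : X → ℝ≥0∞} (hT : MeasurePreserving T μ μ) (hg : Measurable g) (n : ℕ) :
    ∫⁻ x, birkhoffExcess T g n x ∂μ ≤ n * ∫⁻ x, g x ∂μ := by
  induction n with
  | zero => simp [birkhoffExcess]
  | succ n ih =>
    calc ∫⁻ x, birkhoffExcess T g (n + 1) x ∂μ
        ≤ ∫⁻ x, (g x + birkhoffExcess T g n (T x)) ∂μ := lintegral_mono fun x => tsub_le_self
      _ = ∫⁻ x, g x ∂μ + ∫⁻ x, birkhoffExcess T g n x ∂μ := by
          rw [lintegral_add_left hg, hT.lintegral_comp (measurable_birkhoffExcess hT.measurable hg n)]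
      _ ≤ _ := by
          push_cast
          rw [add_mul, one_mul, add_comm]
          gcongr

/-- Garsia's argument. Write `P` for the excess. Where `P > 0` the truncated subtraction is a
genuine one, so monotonicity in `n` gives `P + 1 ≤ g + P ∘ T`; elsewhere `P = 0`. Integrating, `∫ P`
cancels by invariance, which is legitimate because it is finite. -/
lemma measure_birkhoffExcess_pos_le {X : Type*} [MeasurableSpace X] {μ : Measure X} {T : X → X}
    {g : X → ℝ≥0∞} (hT : MeasurePreserving T μ μ) (hg : Measurable g) (n : ℕ) :
    μ {x | 0 < birkhoffExcess T g n x} ≤ ∫⁻ x, g x ∂μ := by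
  by_cases hfin : ∫⁻ x, g x ∂μ = ∞
  · simp [hfin]
  have hP := measurable_birkhoffExcess hT.measurable hg n
  have hD : MeasurableSet {x | 0 < birkhoffExcess T g n x} := measurableSet_lt measurable_const hP
  have hPfin : ∫⁻ x, birkhoffExcess T g n x ∂μ ≠ ∞ :=
    ne_top_of_le_ne_top (ENNReal.mul_ne_top (by simp) hfin) (lintegral_birkhoffExcess_le hT hg n)
  have key : ∀ x, birkhoffExcess T g n x + {x | 0 < birkhoffExcess T g n x}.indicator 1 x ≤
      g x + birkhoffExcess T g n (T x) := by
    intro x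
    by_cases hx : 0 < birkhoffExcess T g n x
    · rw [Set.indicator_of_mem (by exact hx)]
      cases n with
      | zero => simp [birkhoffExcess] at hx
      | succ n =>
        rw [birkhoffExcess] at hx ⊢
        rw [Pi.one_apply, tsub_add_cancel_of_le (tsub_pos_iff_lt.1 hx).le]
        gcongr
        exact birkhoffExcess_le_succ T g n _
    · rw [Set.indicator_of_notMem (by exact hx)]
      simp [nonpos_iff_eq_zero.1 (not_lt.1 hx)]
  have h := lintegral_mono (μ := μ) key
  rw [lintegral_add_left hP, lintegral_indicator_one hD, lintegral_add_left hg,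
    hT.lintegral_comp hP, add_comm (∫⁻ x, g x ∂μ)] at h
  exact (ENNReal.add_le_add_iff_left hPfin).1 h

/-- The **maximal ergodic theorem** for nonnegative functions at height one. -/
theorem exists_measurableSet_birkhoffSum_le {X : Type*} [MeasurableSpace X] {μ : Measure X}
    {T : X → X} {g : X → ℝ≥0∞} (hT : MeasurePreserving T μ μ) (hg : Measurable g) :
    ∃ D : Set X, MeasurableSet D ∧ μ D ≤ ∫⁻ x, g x ∂μ ∧
      ∀ x ∉ D, ∀ n : ℕ, birkhoffSum T g n x ≤ n := by
  refine ⟨⋃ n, {x | 0 < birkhoffExcess T g n x}, MeasurableSet.iUnion fun n =>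
    measurableSet_lt measurable_const (measurable_birkhoffExcess hT.measurable hg n), ?_, ?_⟩
  · rw [Monotone.measure_iUnion]
    · exact iSup_le fun n => measure_birkhoffExcess_pos_le hT hg n
    · exact monotone_nat_of_le_succ fun n x hx => lt_of_lt_of_le hx (birkhoffExcess_le_succ T g n x)
  · intro x hx n
    have h0 : birkhoffExcess T g n x = 0 := by
      by_contra h
      exact hx (Set.mem_iUnion.2 ⟨n, pos_iff_ne_zero.2 h⟩)
    simpa [h0] using birkhoffSum_le_birkhoffExcess_add T g n x

/-! ### Two-sided orbits. -/

lemma measurePreserving_zpow {X : Type*} [MeasurableSpace X] {μ : Measure X} {τ : X ≃ᵐ X}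
    (hτ : MeasurePreserving τ μ μ) (m : ℤ) :
    MeasurePreserving (fun x => (τ.toEquiv ^ m : Equiv.Perm X) x) μ μ := by
  cases m with
  | ofNat n =>
    have h : (fun x => (τ.toEquiv ^ (Int.ofNat n) : Equiv.Perm X) x) = τ^[n] := by
      ext x
      simp only [Int.ofNat_eq_natCast, zpow_natCast]
      rw [← Equiv.Perm.iterate_eq_pow]
      rfl
    rw [h]
    exact hτ.iterate n
  | negSucc n =>
    have h : (fun x => (τ.toEquiv ^ (Int.negSucc n) : Equiv.Perm X) x) = τ.symm^[n + 1] := by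
      ext x
      rw [zpow_negSucc, ← inv_pow, ← Equiv.Perm.iterate_eq_pow]
      rfl
    rw [h]
    exact (hτ.symm τ).iterate _

lemma sum_Icc_neg_le {w : ℤ → ℝ≥0∞} (N : ℕ) :
    ∑ i ∈ Finset.Icc (-N : ℤ) N, w i ≤
      ∑ k ∈ Finset.range (N + 1), w k + ∑ k ∈ Finset.range (N + 1), w (-k) := by
  classical
  have hsub : Finset.Icc (-N : ℤ) N ⊆ (Finset.range (N + 1)).image (fun k : ℕ => (k : ℤ)) ∪
      (Finset.range (N + 1)).image (fun k : ℕ => (-k : ℤ)) := by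
    intro i hi
    rw [Finset.mem_Icc] at hi
    simp only [Finset.mem_union, Finset.mem_image, Finset.mem_range]
    rcases le_total 0 i with h | h
    · exact Or.inl ⟨i.toNat, by omega, by omega⟩
    · exact Or.inr ⟨(-i).toNat, by omega, by omega⟩
  refine (Finset.sum_le_sum_of_subset hsub).trans ?_
  refine (le_self_add.trans_eq Finset.sum_union_inter).trans_eq ?_
  rw [Finset.sum_image (by intro a _ b _; simp), Finset.sum_image (by intro a _ b _; simp)]

/-- The two-sided weak-type maximal inequality along the orbits of an invertible transformation. -/
theorem exists_measurableSet_sum_zpow_le {X : Type*} [MeasurableSpace X] {μ : Measure X}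
    {τ : X ≃ᵐ X} {g : X → ℝ≥0∞} (hτ : MeasurePreserving τ μ μ) (hg : Measurable g) :
    ∃ D : Set X, MeasurableSet D ∧ μ D ≤ 2 * ∫⁻ x, g x ∂μ ∧ ∀ x ∉ D, ∀ N : ℕ,
      ∑ i ∈ Finset.Icc (-N : ℤ) N, g ((τ.toEquiv ^ i : Equiv.Perm X) x) ≤ 2 * (N + 1) := by
  obtain ⟨D, hD, hμD, hsum⟩ := exists_measurableSet_birkhoffSum_le hτ hg
  obtain ⟨D', hD', hμD', hsum'⟩ := exists_measurableSet_birkhoffSum_le (hτ.symm τ) hg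
  refine ⟨D ∪ D', hD.union hD', ?_, fun x hx N => ?_⟩
  · calc μ (D ∪ D') ≤ μ D + μ D' := measure_union_le _ _
      _ ≤ _ := by rw [two_mul]; gcongr
  · rw [Set.mem_union, not_or] at hx
    refine (sum_Icc_neg_le (w := fun i => g ((τ.toEquiv ^ i : Equiv.Perm X) x)) N).trans ?_
    have h1 := hsum x hx.1 (N + 1)
    have h2 := hsum' x hx.2 (N + 1)
    rw [two_mul]
    push_cast at h1 h2
    refine add_le_add (le_trans (le_of_eq ?_) h1) (le_trans (le_of_eq ?_) h2)
    · refine Finset.sum_congr rfl fun k _ => ?_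
      rw [zpow_natCast, ← Equiv.Perm.iterate_eq_pow]
      rfl
    · refine Finset.sum_congr rfl fun k _ => ?_
      rw [zpow_neg, zpow_natCast, ← inv_pow, ← Equiv.Perm.iterate_eq_pow]
      rfl

/-! ### Counting exceedances along a single orbit. -/

lemma sum_range_two_pow_le (K : ℕ) : ∑ k ∈ Finset.range K, (2 : ℝ≥0∞) ^ k ≤ 2 ^ K := by
  induction K with
  | zero => simp
  | succ K ih =>
    rw [Finset.sum_range_succ, pow_succ, mul_two]
    gcongr

/-- The sum splits at the first `K` with `a < 2 ^ K`. Below `K` the entry `1` of the minimum gives a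
geometric sum dominated by its last term; from `K` on, the power `q > 1` gives a series of ratio
`2⁻¹ ^ (q - 1) < 1`. -/
lemma tsum_min_dyadic_le {q : ℝ} (hq : 1 < q) {a : ℝ≥0∞} (ha : a ≠ ∞) :
    ∑' k : ℕ, (2 : ℝ≥0∞) ^ k * min 1 ((a / 2 ^ k) ^ q) ≤
      (2 + (1 - (2⁻¹ : ℝ≥0∞) ^ (q - 1))⁻¹) * a := by
  classical
  have hex : ∃ K : ℕ, a < 2 ^ K := by
    obtain ⟨n, hn⟩ := ENNReal.exists_nat_gt ha
    refine ⟨n, hn.trans_le ?_⟩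
    exact_mod_cast Nat.lt_two_pow_self.le
  let K := Nat.find hex
  have hK : a < 2 ^ K := Nat.find_spec hex
  rw [← ENNReal.summable.sum_add_tsum_nat_add' (k := K), add_mul]
  refine add_le_add ?_ ?_
  · have hK' : ∑ k ∈ Finset.range K, (2 : ℝ≥0∞) ^ k ≤ 2 * a := by
      rcases Nat.eq_zero_or_pos K with h | h
      · simp [h]
      · obtain ⟨L, hL⟩ := Nat.exists_eq_succ_of_ne_zero h.ne'
        have h2 : 2 ^ L ≤ a := not_lt.1 (Nat.find_min hex (m := L) (by omega))
        refine (sum_range_two_pow_le K).trans ?_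
        rw [hL, pow_succ, mul_comm]
        gcongr
    refine le_trans (Finset.sum_le_sum fun k _ => ?_) hK'
    exact (mul_le_mul_right (min_le_left _ _) _).trans_eq (mul_one _)
  · rw [← ENNReal.tsum_geometric, ← ENNReal.tsum_mul_right]
    refine ENNReal.tsum_le_tsum fun j => ?_
    set v := a / 2 ^ (j + K) with hv
    have hv1 : v ≤ 2⁻¹ ^ j := by
      rw [hv]
      refine ENNReal.div_le_of_le_mul ?_
      rw [pow_add, ← mul_assoc, ← mul_pow, ENNReal.inv_mul_cancel (by simp) (by simp), one_pow,
        one_mul]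
      exact hK.le
    have hva : 2 ^ (j + K) * v = a := ENNReal.mul_div_cancel (by simp) (by simp)
    have hvq : v ^ q ≤ v * (2⁻¹ ^ (q - 1)) ^ j := by
      rcases eq_or_ne v 0 with h0 | h0
      · rw [h0, ENNReal.zero_rpow_of_pos (by linarith)]
        exact zero_le
      have hvt : v ≠ ∞ := ne_top_of_le_ne_top (by simp) hv1
      calc v ^ q = v ^ (1 + (q - 1)) := by congr 1; ring
        _ = v * v ^ (q - 1) := by rw [ENNReal.rpow_add _ _ h0 hvt, ENNReal.rpow_one]
        _ ≤ v * (2⁻¹ ^ j) ^ (q - 1) := by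
            gcongr
        _ = _ := by
            rw [← ENNReal.rpow_natCast, ← ENNReal.rpow_mul, mul_comm (j : ℝ), ENNReal.rpow_mul,
              ENNReal.rpow_natCast]
    calc (2 : ℝ≥0∞) ^ (j + K) * min 1 (v ^ q) ≤ 2 ^ (j + K) * (v * (2⁻¹ ^ (q - 1)) ^ j) := by
          gcongr
          exact (min_le_right _ _).trans hvq
      _ = _ := by rw [← mul_assoc, hva, mul_comm]

/-- A dyadic block of tail exceedances, seen from a good base point, is small. -/
lemma card_dyadic_exceedance_le {q : ℝ} (hq : 1 < q) {W : ℤ → ℝ≥0∞} {B : Set ℤ}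
    (hB : ∀ n ∉ B, ∀ N : ℕ, ∑ i ∈ Finset.Icc (-N : ℤ) N, W (n + i) ^ q ≤ 2 * (N + 1))
    {c d : ℤ} (hc : |c| ≤ 2) (hd : |d| = 1) (a : ℝ≥0∞) (k : ℕ) (s : Finset ℤ)
    (hs : ∀ m ∈ s, c * m ∉ B ∧ 2 ^ k ≤ m.natAbs + 1 ∧ m.natAbs + 1 < 2 ^ (k + 1) ∧
      (m.natAbs + 1 : ℝ≥0∞) < a * W (d * m)) :
    (s.card : ℝ≥0∞) ≤ 16 * (2 ^ k * min 1 ((a / 2 ^ k) ^ q)) := by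
  classical
  rcases s.eq_empty_or_nonempty with rfl | ⟨m₀, hm₀⟩
  · simp
  have hq0 : 0 ≤ q := by linarith
  have hpos : 1 ≤ 2 ^ k := Nat.one_le_two_pow
  have hpow : 2 ^ (k + 1) = 2 * 2 ^ k := by rw [pow_succ]; ring
  rw [← mul_assoc, mul_min, le_min_iff]
  constructor
  · have hsub : s ⊆ Finset.Icc (-(2 ^ (k + 1) : ℕ) : ℤ) (2 ^ (k + 1) : ℕ) := by
      intro m hm
      obtain ⟨-, -, h, -⟩ := hs m hm
      rw [Finset.mem_Icc]
      omega
    have hcard := Finset.card_le_card hsub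
    rw [Int.card_Icc] at hcard
    have h2 : s.card ≤ 16 * 2 ^ k := by omega
    rw [mul_one]
    exact_mod_cast h2
  -- Since `|m|` and `|m₀|` are below `2 ^ (k + 1)`, `|d * m - c * m₀| ≤ |m| + 2 * |m₀| ≤ 3 * 2 ^ (k
  -- + 1)`: a window of this radius around the good point `c * m₀` sees the whole block.
  · set N : ℕ := 6 * 2 ^ k with hN
    have hinj : Set.InjOn (fun m : ℤ => d * m - c * m₀) s := by
      intro m _ m' _ h
      have h' : d * m = d * m' := by simpa using h
      refine mul_left_cancel₀ ?_ h'
      rintro rfl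
      simp at hd
    have himage : s.image (fun m : ℤ => d * m - c * m₀) ⊆ Finset.Icc (-N : ℤ) N := by
      intro i hi
      obtain ⟨m, hm, rfl⟩ := Finset.mem_image.1 hi
      obtain ⟨-, -, h, -⟩ := hs m hm
      obtain ⟨-, -, h₀, -⟩ := hs m₀ hm₀
      rw [Finset.mem_Icc, ← abs_le]
      calc |d * m - c * m₀| ≤ |d * m| + |c * m₀| := abs_sub _ _
        _ = |m| + |c| * |m₀| := by rw [abs_mul, abs_mul, hd, one_mul]
        _ ≤ |m| + 2 * |m₀| := by gcongr
        _ ≤ N := by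
            rw [Int.abs_eq_natAbs, Int.abs_eq_natAbs]
            omega
    have hsum : ∑ m ∈ s, W (d * m) ^ q ≤ 16 * 2 ^ k := by
      calc ∑ m ∈ s, W (d * m) ^ q
          = ∑ i ∈ s.image (fun m : ℤ => d * m - c * m₀), W (c * m₀ + i) ^ q := by
            rw [Finset.sum_image hinj]
            simp
        _ ≤ ∑ i ∈ Finset.Icc (-N : ℤ) N, W (c * m₀ + i) ^ q := Finset.sum_le_sum_of_subset himage
        _ ≤ 2 * (N + 1) := hB _ (hs m₀ hm₀).1 N
        _ ≤ 16 * 2 ^ k := by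
            have : 2 * (N + 1) ≤ 16 * 2 ^ k := by omega
            exact_mod_cast this
    -- Chebyshev: every `m` in the block has `2 ^ k ≤ a * W (d * m)`.
    have hle : (s.card : ℝ≥0∞) * (2 ^ k) ^ q ≤ a ^ q * (16 * 2 ^ k) := by
      calc (s.card : ℝ≥0∞) * (2 ^ k) ^ q = ∑ _m ∈ s, ((2 : ℝ≥0∞) ^ k) ^ q := by simp
        _ ≤ ∑ m ∈ s, a ^ q * W (d * m) ^ q := by
            refine Finset.sum_le_sum fun m hm => ?_
            obtain ⟨-, h, -, h'⟩ := hs m hm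
            rw [← ENNReal.mul_rpow_of_nonneg _ _ hq0]
            refine ENNReal.rpow_le_rpow (le_trans ?_ h'.le) hq0
            exact_mod_cast h
        _ = a ^ q * ∑ m ∈ s, W (d * m) ^ q := by rw [Finset.mul_sum]
        _ ≤ _ := by gcongr
    rw [ENNReal.div_rpow_of_nonneg _ _ hq0, ← mul_div_assoc, mul_comm]
    rw [mul_comm, mul_comm _ (a ^ q)]
    refine (ENNReal.le_div_iff_mul_le (Or.inl ?_) (Or.inl ?_)).2 hle
    · simp
    · exact ENNReal.rpow_ne_top_of_nonneg hq0 (by simp)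

/-- The number of exceedances along an orbit, seen from good base points, is controlled linearly. -/
theorem tsum_exceedance_le {q : ℝ} (hq : 1 < q) {W : ℤ → ℝ≥0∞} {B : Set ℤ}
    (hB : ∀ n ∉ B, ∀ N : ℕ, ∑ i ∈ Finset.Icc (-N : ℤ) N, W (n + i) ^ q ≤ 2 * (N + 1))
    {c d : ℤ} (hc : |c| ≤ 2) (hd : |d| = 1) (a : ℝ≥0∞) :
    ∑' m : ℤ, {m : ℤ | c * m ∉ B ∧ (m.natAbs + 1 : ℝ≥0∞) < a * W (d * m)}.indicator 1 m ≤
      16 * (2 + (1 - (2⁻¹ : ℝ≥0∞) ^ (q - 1))⁻¹) * a := by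
  classical
  rcases eq_or_ne a ∞ with rfl | ha
  · rw [ENNReal.mul_top (by simp)]
    exact le_top
  set S := {m : ℤ | c * m ∉ B ∧ (m.natAbs + 1 : ℝ≥0∞) < a * W (d * m)} with hS
  let s : ℕ → Finset ℤ := fun k => (Finset.Icc (-(2 ^ (k + 1) : ℕ) : ℤ) (2 ^ (k + 1) : ℕ)).filter
    fun m => m ∈ S ∧ 2 ^ k ≤ m.natAbs + 1 ∧ m.natAbs + 1 < 2 ^ (k + 1)
  calc ∑' m : ℤ, S.indicator (1 : ℤ → ℝ≥0∞) m
      ≤ ∑' m : ℤ, ∑' k : ℕ, (s k : Set ℤ).indicator 1 m := by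
        refine ENNReal.tsum_le_tsum fun m => ?_
        by_cases hm : m ∈ S
        · refine le_trans ?_ (ENNReal.le_tsum (Nat.log 2 (m.natAbs + 1)))
          have h1 : 2 ^ Nat.log 2 (m.natAbs + 1) ≤ m.natAbs + 1 := Nat.pow_log_le_self 2 (by omega)
          have h2 : m.natAbs + 1 < 2 ^ (Nat.log 2 (m.natAbs + 1) + 1) :=
            Nat.lt_pow_succ_log_self (by norm_num) _
          rw [Set.indicator_of_mem hm, Set.indicator_of_mem]
          rw [Finset.mem_coe, Finset.mem_filter, Finset.mem_Icc]
          exact ⟨by omega, hm, h1, h2⟩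
        · rw [Set.indicator_of_notMem hm]
          exact zero_le
    _ = ∑' k : ℕ, ((s k).card : ℝ≥0∞) := by
        rw [ENNReal.tsum_comm]
        refine tsum_congr fun k => ?_
        rw [← tsum_subtype, Finset.tsum_subtype']
        simp
    _ ≤ ∑' k : ℕ, 16 * (2 ^ k * min 1 ((a / 2 ^ k) ^ q)) := by
        refine ENNReal.tsum_le_tsum fun k => ?_
        refine card_dyadic_exceedance_le hq hB hc hd a k (s k) fun m hm => ?_
        obtain ⟨-, hm, h1, h2⟩ := Finset.mem_filter.1 hm
        exact ⟨hm.1, h1, h2, hm.2⟩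
    _ ≤ _ := by
        rw [ENNReal.tsum_mul_left, mul_assoc]
        gcongr
        exact tsum_min_dyadic_le hq ha

/-! ### From orbits to the measure of the exceedance set. -/

lemma ae_forall_zpow {X : Type*} [MeasurableSpace X] {μ : Measure X} {τ : X ≃ᵐ X}
    (hτ : MeasurePreserving τ μ μ) {P : X → Prop} (hP : ∀ᵐ x ∂μ, P x) :
    ∀ᵐ x ∂μ, ∀ m : ℤ, P ((τ.toEquiv ^ m : Equiv.Perm X) x) :=
  ae_all_iff.2 fun m => (measurePreserving_zpow hτ m).quasiMeasurePreserving.ae hP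

/-- The set of points at which the bilinear tail maximal operator along the times `i * m` and
`j * m` exceeds one. -/
def tailExceedance {X : Type*} [MeasurableSpace X] (τ : X ≃ᵐ X) (i j : ℤ) (F H : X → ℝ≥0∞) :
    Set X :=
  {x | ∃ m : ℤ, (m.natAbs + 1 : ℝ≥0∞) <
    F ((τ.toEquiv ^ (i * m) : Equiv.Perm X) x) * H ((τ.toEquiv ^ (j * m) : Equiv.Perm X) x)}

lemma measure_tailExceedance_le_add {X : Type*} [MeasurableSpace X] {μ : Measure X} {τ : X ≃ᵐ X}
    (hτ : MeasurePreserving τ μ μ) {q : ℝ} (hq : 1 < q) {F H : X → ℝ≥0∞} (hF : Measurable F)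
    (hH : Measurable H) {D : Set X} (hD : MeasurableSet D)
    (hsum : ∀ x ∉ D, ∀ N : ℕ,
      ∑ n ∈ Finset.Icc (-N : ℤ) N, H ((τ.toEquiv ^ n : Equiv.Perm X) x) ^ q ≤ 2 * (N + 1))
    {i j : ℤ} (hi : |i| ≤ 2) (hij : |j - i| = 1) :
    μ (tailExceedance τ i j F H) ≤
      μ D + 16 * (2 + (1 - (2⁻¹ : ℝ≥0∞) ^ (q - 1))⁻¹) * ∫⁻ x, F x ∂μ := by
  have hmeas : ∀ m : ℤ, Measurable fun x => (τ.toEquiv ^ m : Equiv.Perm X) x :=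
    fun m => (measurePreserving_zpow hτ m).measurable
  -- With `y = τ^(i m) x`, the point `x = τ^(-i m) y` is the good base point and `H` is evaluated at
  -- `τ^((j - i) m) y`; this fixes `c = -i` and `d = j - i` in the count below.
  let E : ℤ → Set X := fun m => {y | (τ.toEquiv ^ (-i * m) : Equiv.Perm X) y ∉ D ∧
    (m.natAbs + 1 : ℝ≥0∞) < F y * H ((τ.toEquiv ^ ((j - i) * m) : Equiv.Perm X) y)}
  have hE : ∀ m, MeasurableSet (E m) := fun m =>
    ((hmeas _) hD.compl).inter (measurableSet_lt measurable_const (hF.mul (hH.comp (hmeas _))))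
  have hcover : tailExceedance τ i j F H ⊆
      D ∪ ⋃ m : ℤ, (fun x => (τ.toEquiv ^ (i * m) : Equiv.Perm X) x) ⁻¹' E m := by
    rintro x ⟨m, hm⟩
    by_cases hx : x ∈ D
    · exact Or.inl hx
    · refine Or.inr (Set.mem_iUnion.2 ⟨m, ?_, ?_⟩)
      · rw [← Equiv.Perm.mul_apply, ← zpow_add]
        simpa using hx
      · rw [← Equiv.Perm.mul_apply, ← zpow_add]
        convert hm using 5
        ring_nf
  calc μ (tailExceedance τ i j F H)
      ≤ μ D + ∑' m : ℤ, μ ((fun x => (τ.toEquiv ^ (i * m) : Equiv.Perm X) x) ⁻¹' E m) :=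
        (measure_mono hcover).trans ((measure_union_le _ _).trans
          (add_le_add_right (measure_iUnion_le _) _))
    _ = μ D + ∫⁻ y, ∑' m : ℤ, (E m).indicator 1 y ∂μ := by
        rw [lintegral_tsum fun m => (measurable_one.indicator (hE m)).aemeasurable]
        congr 1
        refine tsum_congr fun m => ?_
        rw [(measurePreserving_zpow hτ _).measure_preimage (hE m).nullMeasurableSet,
          lintegral_indicator_one (hE m)]
    _ ≤ μ D + ∫⁻ y, 16 * (2 + (1 - (2⁻¹ : ℝ≥0∞) ^ (q - 1))⁻¹) * F y ∂μ := by
        refine add_le_add_right (lintegral_mono fun y => ?_) _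
        refine le_trans (le_of_eq ?_) (tsum_exceedance_le hq
          (W := fun n => H ((τ.toEquiv ^ n : Equiv.Perm X) y))
          (B := {n | (τ.toEquiv ^ n : Equiv.Perm X) y ∈ D}) ?_ (c := -i) (d := j - i)
          (by rwa [abs_neg]) hij (F y))
        · rfl
        · intro n hn N
          have h := hsum _ hn N
          simp only [← Equiv.Perm.mul_apply, ← zpow_add] at h
          simpa only [add_comm n] using h
    _ = _ := by rw [lintegral_const_mul _ hF]

/-! ### Normalisation and homogeneity. -/

lemma one_sub_two_inv_rpow_inv_ne_top {s : ℝ} (hs : 0 < s) :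
    (1 - (2⁻¹ : ℝ≥0∞) ^ s)⁻¹ ≠ ∞ := by
  rw [ENNReal.inv_ne_top]
  refine (tsub_pos_iff_lt.2 ?_).ne'
  exact ENNReal.rpow_lt_one (by simp) hs

lemma exists_measure_tailExceedance_le {X : Type*} [MeasurableSpace X] {μ : Measure X}
    {τ : X ≃ᵐ X} (hτ : MeasurePreserving τ μ μ) {q : ℝ≥0∞} (hq : 1 < q) {i j : ℤ} (hi : |i| ≤ 2)
    (hij : |j - i| = 1) :
    ∃ K : ℝ≥0∞, K ≠ ∞ ∧ ∀ (F H : X → ℝ≥0∞) (V : ℝ≥0∞), Measurable F → Measurable H →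
      ∫⁻ x, F x ∂μ ≤ V → eLpNorm H q μ ≤ V ^ q.toReal⁻¹ →
        μ (tailExceedance τ i j F H) ≤ K * V := by
  rcases eq_or_ne q ∞ with rfl | hqt
  -- For `q = ∞`, `q.toReal⁻¹ = 0`, so the hypothesis reads `‖H‖_∞ ≤ 1`. The bad set is then null,
  -- and any finite exponent above one serves in the count; `2` is taken.
  · refine ⟨16 * (2 + (1 - (2⁻¹ : ℝ≥0∞) ^ ((2 : ℝ) - 1))⁻¹), ENNReal.mul_ne_top (by simp)
      (ENNReal.add_ne_top.2 ⟨by simp, one_sub_two_inv_rpow_inv_ne_top (by norm_num)⟩),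
      fun F H V hF hH hFV hHV => ?_⟩
    have hH1 : ∀ᵐ x ∂μ, H x ≤ 1 := by
      filter_upwards [ae_le_eLpNormEssSup (f := H) (μ := μ)] with x hx
      refine hx.trans ?_
      simpa using hHV
    have hmeas : ∀ m : ℤ, Measurable fun x => (τ.toEquiv ^ m : Equiv.Perm X) x :=
      fun m => (measurePreserving_zpow hτ m).measurable
    set D : Set X := {x | ∀ m : ℤ, H ((τ.toEquiv ^ m : Equiv.Perm X) x) ≤ 1}ᶜ with hDdef
    have hD : MeasurableSet D := by
      refine MeasurableSet.compl ?_
      simp only [Set.ofPred_forall]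
      exact MeasurableSet.iInter fun m => measurableSet_le (hH.comp (hmeas m)) measurable_const
    have hD0 : μ D = 0 := ae_forall_zpow hτ hH1
    have h := measure_tailExceedance_le_add hτ one_lt_two hF hH hD ?_ hi hij
    · rw [hD0, zero_add] at h
      exact h.trans (by gcongr)
    · intro x hx N
      rw [hDdef, Set.notMem_compl_iff] at hx
      calc _ ≤ ∑ n ∈ Finset.Icc (-N : ℤ) N, (1 : ℝ≥0∞) :=
            Finset.sum_le_sum fun n _ => ENNReal.rpow_le_one (hx n) (by norm_num)
        _ ≤ _ := by
            rw [Finset.sum_const, nsmul_one, Int.card_Icc]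
            have : ((N : ℤ) + 1 - -N).toNat ≤ 2 * (N + 1) := by omega
            exact_mod_cast this
  · have hq1 : 1 < q.toReal := by
      rwa [← ENNReal.toReal_one, ENNReal.toReal_lt_toReal ENNReal.one_ne_top hqt]
    refine ⟨2 + 16 * (2 + (1 - (2⁻¹ : ℝ≥0∞) ^ (q.toReal - 1))⁻¹), ENNReal.add_ne_top.2
      ⟨by simp, ENNReal.mul_ne_top (by simp) (ENNReal.add_ne_top.2
        ⟨by simp, one_sub_two_inv_rpow_inv_ne_top (by linarith)⟩)⟩, fun F H V hF hH hFV hHV => ?_⟩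
    obtain ⟨D, hD, hμD, hsum⟩ := exists_measurableSet_sum_zpow_le hτ (hH.pow_const q.toReal)
    have hHint : ∫⁻ x, H x ^ q.toReal ∂μ ≤ V := by
      rw [eLpNorm_eq_lintegral_rpow_enorm_toReal (by positivity) hqt, one_div,
        ENNReal.rpow_le_rpow_iff (by positivity)] at hHV
      simpa using hHV
    refine (measure_tailExceedance_le_add hτ hq1 hF hH hD hsum hi hij).trans ?_
    rw [add_mul]
    gcongr
    exact hμD.trans (by gcongr)

/-- The weak-type bound for the exceedance sets, in homogeneous form. -/
theorem exists_measure_tailExceedance_le_rpow {X : Type*} [MeasurableSpace X] {μ : Measure X}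
    {τ : X ≃ᵐ X} (hτ : MeasurePreserving τ μ μ) {q : ℝ≥0∞} (hq : 1 < q) {i j : ℤ} (hi : |i| ≤ 2)
    (hij : |j - i| = 1) :
    ∃ K : ℝ≥0∞, K ≠ ∞ ∧ ∀ (F H : X → ℝ≥0∞) (α : ℝ≥0∞), Measurable F → Measurable H →
      ∫⁻ x, F x ∂μ ≠ ∞ → eLpNorm H q μ ≠ ∞ → α ≠ 0 → α ≠ ∞ →
        μ (tailExceedance τ i j (fun x => α⁻¹ * F x) H) ≤
          K * (α⁻¹ * (∫⁻ x, F x ∂μ) * eLpNorm H q μ) ^ (1 + q.toReal⁻¹)⁻¹ := by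
  obtain ⟨K, hK, hKV⟩ := exists_measure_tailExceedance_le hτ hq hi hij
  refine ⟨K, hK, fun F H α hF hH hFfin hHfin hα0 hαt => ?_⟩
  set A := ∫⁻ x, F x ∂μ with hA
  set b := eLpNorm H q μ with hb
  have hs : 0 < 1 + q.toReal⁻¹ := by positivity
  -- The rescaling divides by both norms; if either vanishes, the exceedance set is null.
  rcases eq_or_ne A 0 with hA0 | hA0
  · have hF0 : ∀ᵐ x ∂μ, F x = 0 := (lintegral_eq_zero_iff hF).1 hA0
    refine le_trans (le_of_eq (measure_mono_null ?_ (ae_forall_zpow hτ hF0))) zero_le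
    rintro x ⟨m, hm⟩ hx
    simp [hx (i * m)] at hm
  rcases eq_or_ne b 0 with hb0 | hb0
  · have hH0 : ∀ᵐ x ∂μ, H x = 0 :=
      (eLpNorm_eq_zero_iff hH.aestronglyMeasurable (by positivity)).1 hb0
    refine le_trans (le_of_eq (measure_mono_null ?_ (ae_forall_zpow hτ hH0))) zero_le
    rintro x ⟨m, hm⟩ hx
    simp [hx (j * m)] at hm
  -- `V` solves `V * V ^ (1 / q) = U`. Thus `F` and `H` can be rescaled to norms `V` and `V ^ (1 /
  -- q)` by factors whose product is `α⁻¹`, which leaves the exceedance set unchanged.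
  set U := α⁻¹ * A * b with hU
  set V := U ^ (1 + q.toReal⁻¹)⁻¹ with hV
  have hU0 : U ≠ 0 := by simp [hU, hA0, hb0, hαt]
  have hUt : U ≠ ∞ := ENNReal.mul_ne_top (ENNReal.mul_ne_top (by simp [hα0]) hFfin) hHfin
  have hV0 : V ≠ 0 := by simp [hV, ENNReal.rpow_eq_zero_iff, hU0, hUt]
  have hVt : V ≠ ∞ := by simp [hV, ENNReal.rpow_eq_top_iff, hU0, hUt]
  have hVU : V * V ^ q.toReal⁻¹ = U := by
    nth_rewrite 1 [← ENNReal.rpow_one V]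
    rw [← ENNReal.rpow_add _ _ hV0 hVt, hV, ← ENNReal.rpow_mul, inv_mul_cancel₀ hs.ne',
      ENNReal.rpow_one]
  have hst : (V * A⁻¹) * (V ^ q.toReal⁻¹ * b⁻¹) = α⁻¹ := by
    calc (V * A⁻¹) * (V ^ q.toReal⁻¹ * b⁻¹) = (V * V ^ q.toReal⁻¹) * (A⁻¹ * b⁻¹) := by ring
      _ = α⁻¹ * (A * A⁻¹) * (b * b⁻¹) := by rw [hVU, hU]; ring
      _ = α⁻¹ := by
        rw [ENNReal.mul_inv_cancel hA0 hFfin, ENNReal.mul_inv_cancel hb0 hHfin, mul_one, mul_one]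
  have hset : tailExceedance τ i j (fun x => α⁻¹ * F x) H =
      tailExceedance τ i j (fun x => V * A⁻¹ * F x) (fun x => V ^ q.toReal⁻¹ * b⁻¹ * H x) := by
    ext x
    refine exists_congr fun m => ?_
    rw [mul_mul_mul_comm, hst, mul_assoc]
  rw [hset]
  refine hKV _ _ V (hF.const_mul _) (hH.const_mul _) ?_ ?_
  · rw [lintegral_const_mul _ hF, mul_assoc, ENNReal.inv_mul_cancel hA0 hFfin, mul_one]
  · refine (eLpNorm_le_mul_eLpNorm_of_ae_le_mul'' q hH.aestronglyMeasurable
      (Filter.Eventually.of_forall fun x => le_rfl)).trans_eq ?_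
    rw [← hb, mul_assoc, ENNReal.inv_mul_cancel hb0 hHfin, mul_one]

/-! ### Scalar functions and the two endpoint estimates. -/

lemma lt_bilinearTailMaximal_iff {X 𝕜 : Type*} [MeasurableSpace X] [RCLike 𝕜] (τ : X ≃ᵐ X)
    (f h : X → 𝕜) (x : X) (β : ℝ≥0∞) :
    β < bilinearTailMaximal τ f h x ↔ ∃ m : ℤ, β * (m.natAbs + 1) <
      ‖f ((τ.toEquiv ^ m : Equiv.Perm X) x)‖ₑ *
        ‖h ((τ.toEquiv ^ (2 * m) : Equiv.Perm X) x)‖ₑ := by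
  rw [bilinearTailMaximal, lt_iSup_iff]
  refine exists_congr fun m => ?_
  have hcast : ((|m| + 1 : ℤ) : 𝕜) = ((m.natAbs + 1 : ℕ) : 𝕜) := by
    rw [Int.abs_eq_natAbs]
    exact Int.cast_natCast (m.natAbs + 1)
  have hnorm : ‖((m.natAbs + 1 : ℕ) : 𝕜)‖ₑ = (m.natAbs + 1 : ℝ≥0∞) := by
    rw [← ofReal_norm, RCLike.norm_natCast, ENNReal.ofReal_natCast]
    push_cast
    rfl
  have hne : ((m.natAbs + 1 : ℕ) : 𝕜) ≠ 0 := Nat.cast_ne_zero.2 (Nat.succ_ne_zero _)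
  rw [bilinearTail, hcast, div_eq_mul_inv, enorm_mul, enorm_mul, enorm_inv hne, hnorm,
    ← div_eq_mul_inv]
  exact ENNReal.lt_div_iff_mul_lt (Or.inl (by simp)) (Or.inl (by finiteness))

theorem exists_measureReal_exceedance_le {X : Type*} (𝕜 : Type*) [RCLike 𝕜] [MeasurableSpace X]
    {μ : Measure X} {τ : X ≃ᵐ X} (hτ : MeasurePreserving τ μ μ) {q : ℝ≥0∞} (hq : 1 < q)
    {i j : ℤ} (hi : |i| ≤ 2) (hij : |j - i| = 1) :
    ∃ C : ℝ, 0 < C ∧ ∀ (α : ℝ) (u v : X → 𝕜), 0 < α → MemLp u 1 μ → MemLp v q μ →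
      μ.real {x | ∃ m : ℤ, ENNReal.ofReal α * (m.natAbs + 1) <
        ‖u ((τ.toEquiv ^ (i * m) : Equiv.Perm X) x)‖ₑ *
          ‖v ((τ.toEquiv ^ (j * m) : Equiv.Perm X) x)‖ₑ} ≤
        C / α ^ (1 + q.toReal⁻¹)⁻¹ * (eLpNorm u 1 μ).toReal ^ (1 + q.toReal⁻¹)⁻¹ *
          (eLpNorm v q μ).toReal ^ (1 + q.toReal⁻¹)⁻¹ := by
  obtain ⟨K, hK, hbound⟩ := exists_measure_tailExceedance_le_rpow hτ hq hi hij
  -- The added `1` makes the constant positive even if `K = 0`.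
  refine ⟨K.toReal + 1, by positivity, fun α u v hα hu hv => ?_⟩
  set r := (1 + q.toReal⁻¹)⁻¹ with hr
  have hr0 : 0 ≤ r := by positivity
  have hα0 : ENNReal.ofReal α ≠ 0 := by simpa using hα
  let F : X → ℝ≥0∞ := fun x => ‖hu.1.mk u x‖ₑ
  let H : X → ℝ≥0∞ := fun x => ‖hv.1.mk v x‖ₑ
  have hF : Measurable F := hu.1.stronglyMeasurable_mk.enorm
  have hH : Measurable H := hv.1.stronglyMeasurable_mk.enorm
  have hFint : ∫⁻ x, F x ∂μ = eLpNorm u 1 μ := by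
    rw [eLpNorm_congr_ae hu.1.ae_eq_mk, eLpNorm_one_eq_lintegral_enorm]
  have hHnorm : eLpNorm H q μ = eLpNorm v q μ := by
    rw [eLpNorm_congr_ae hv.1.ae_eq_mk]
    exact eLpNorm_enorm _
  -- Measurable representatives may replace `u` and `v`, because almost every orbit avoids the null
  -- set of disagreement at all its countably many times.
  have hae := ae_forall_zpow hτ (hu.1.ae_eq_mk.and hv.1.ae_eq_mk)
  have hle : μ {x | ∃ m : ℤ, ENNReal.ofReal α * (m.natAbs + 1) <
        ‖u ((τ.toEquiv ^ (i * m) : Equiv.Perm X) x)‖ₑ *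
          ‖v ((τ.toEquiv ^ (j * m) : Equiv.Perm X) x)‖ₑ} ≤
      μ (tailExceedance τ i j (fun x => (ENNReal.ofReal α)⁻¹ * F x) H) := by
    refine measure_mono_ae ?_
    filter_upwards [hae] with x hx
    rintro ⟨m, hm⟩
    refine ⟨m, ?_⟩
    rw [(hx _).1, (hx _).2] at hm
    rw [mul_assoc, mul_comm, ← div_eq_mul_inv,
      ENNReal.lt_div_iff_mul_lt (Or.inl hα0) (Or.inl ENNReal.ofReal_ne_top), mul_comm]
    exact hm
  have hfin := hbound F H (ENNReal.ofReal α) hF hH (by rw [hFint]; exact hu.2.ne)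
    (by rw [hHnorm]; exact hv.2.ne) hα0 ENNReal.ofReal_ne_top
  rw [hFint, hHnorm] at hfin
  -- Finiteness of the bound is needed for `toReal` to preserve the inequality.
  have htop : K * ((ENNReal.ofReal α)⁻¹ * eLpNorm u 1 μ * eLpNorm v q μ) ^ r ≠ ∞ :=
    ENNReal.mul_ne_top hK (ENNReal.rpow_ne_top_of_nonneg hr0 (ENNReal.mul_ne_top
      (ENNReal.mul_ne_top (by simpa using hα) hu.2.ne) hv.2.ne))
  refine (ENNReal.toReal_mono htop (hle.trans hfin)).trans ?_
  rw [ENNReal.toReal_mul, ← ENNReal.toReal_rpow, ENNReal.toReal_mul, ENNReal.toReal_mul,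
    ENNReal.toReal_inv, ENNReal.toReal_ofReal hα.le,
    Real.mul_rpow (by positivity) (by positivity), Real.mul_rpow (by positivity) (by positivity),
    Real.inv_rpow hα.le, ← mul_assoc, ← mul_assoc, ← div_eq_mul_inv]
  gcongr
  linarith

lemma toReal_eq_of_one_div_eq {r q : ℝ≥0∞} (hq : 1 < q) (h : 1 / r = 1 / 1 + 1 / q) :
    r.toReal = (1 + q.toReal⁻¹)⁻¹ := by
  have hq' : q⁻¹ ≠ ∞ := by simpa using (zero_lt_one.trans hq).ne'
  have h' := congrArg ENNReal.toReal h
  rw [one_div, one_div, one_div, inv_one, ENNReal.toReal_add ENNReal.one_ne_top hq',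
    ENNReal.toReal_inv, ENNReal.toReal_inv, ENNReal.toReal_one] at h'
  rw [← h', inv_inv]

theorem mainTheorem4 {X 𝕜 : Type*} [RCLike 𝕜] [MeasurableSpace X] (μ : Measure X)
    [IsProbabilityMeasure μ] (τ : X ≃ᵐ X) (hτ : Ergodic τ μ)
    (p q r₁ r₂ : ℝ≥0∞) (hp : 1 < p) (hq : 1 < q)
    (hr₁ : 1 / r₁ = 1 / 1 + 1 / q) (hr₂ : 1 / r₂ = 1 / p + 1 / 1) :
    ∃ C : ℝ, 0 < C ∧
      (∀ α : ℝ, 0 < α → ∀ f h : X → 𝕜, MemLp f 1 μ → MemLp h q μ →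
        μ.real {x | ENNReal.ofReal α < bilinearTailMaximal τ f h x} ≤
          C / α ^ r₁.toReal * (eLpNorm f 1 μ).toReal ^ r₁.toReal *
            (eLpNorm h q μ).toReal ^ r₁.toReal) ∧
      (∀ α : ℝ, 0 < α → ∀ f h : X → 𝕜, MemLp f p μ → MemLp h 1 μ →
        μ.real {x | ENNReal.ofReal α < bilinearTailMaximal τ f h x} ≤
          C / α ^ r₂.toReal * (eLpNorm f p μ).toReal ^ r₂.toReal *
            (eLpNorm h 1 μ).toReal ^ r₂.toReal) := by
  have hmp := hτ.toMeasurePreserving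
  obtain ⟨C₁, hC₁, h₁⟩ := exists_measureReal_exceedance_le 𝕜 hmp hq (i := 1) (j := 2)
    (by norm_num) (by norm_num)
  -- In the second estimate the integrable factor is `h`, evaluated at time `2 * m`, so the roles of
  -- the two times and of the two functions are exchanged.
  obtain ⟨C₂, hC₂, h₂⟩ := exists_measureReal_exceedance_le 𝕜 hmp hp (i := 2) (j := 1)
    (by norm_num) (by norm_num)
  rw [toReal_eq_of_one_div_eq hq hr₁, toReal_eq_of_one_div_eq hp (hr₂.trans (add_comm _ _))]
  simp only [one_mul] at h₁ h₂
  refine ⟨C₁ + C₂, by positivity, fun α hα f h hf hh => ?_, fun α hα f h hf hh => ?_⟩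
  · simp only [lt_bilinearTailMaximal_iff]
    refine (h₁ α f h hα hf hh).trans ?_
    gcongr
    linarith
  · simp only [lt_bilinearTailMaximal_iff]
    rw [mul_right_comm]
    simp only [mul_comm ‖f _‖ₑ]
    refine (h₂ α h f hα hh hf).trans ?_
    gcongr
    linarith
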